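/- Let $n\ge 2$. For $k\ge 1$ let $\pi_k:\mathbb{C}^k\to\mathbb{C}^k$ be the symmetrization map, whose $j$-th coordinate at $z=(z_1,\dots,z_k)$ is the elementary symmetric polynomial $\sum_{1\le i_1<\dots<i_j\le k} z_{i_1}\cdots z_{i_j}$ $(1\le j\le k)$, and let $\mathbb{G}_k=\{\pi_k(z): z\in\mathbb{C}^k,\ |z_i|<1 \text{ for } 1\le i\le k\}$ be the open symmetrized polydisc (so $\mathbb{G}_1$ is the open unit disc). Let $(s_1,\dots,s_{n-1},p)\in\mathbb{C}^n$ with $|p|<1$, and put $s_0=1$ and $s_n=p$. Then the following are equivalent: - (i) $(s_1,\dots,s_{n-1},p)\in\mathbb{G}_n$; - (ii) there exists $(\beta_1,\dots,\beta_{n-1})\in\mathbb{G}_{n-1}$ such that $s_j=\beta_j+\overline{\beta_{n-j}}\,p$ for all $j=1,\dots,n-1$; - (iii) the Hermitian $n\times n$ matrix $M=(M_{kl})_{k,l=1}^n$ with entries $$M_{kl}=(-1)^{k+l}\sum_{j=1}^{\min(k,l)}\left(\overline{s_{k-j}}\,s_{l-j}-s_{n-k+j}\,\overline{s_{n-l+j}}\right)$$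 is positive definite. Explicitly, the first row is $1-|p|^2,\ -s_1+\overline{s_{n-1}}\,p,\ \dots,\ (-1)^{n-1}s_{n-1}+(-1)^n\overline{s_1}\,p$, and the $(2,2)$ entry is $1+|s_1|^2-|s_{n-1}|^2-|p|^2$. -/

import Mathlib

open scoped ComplexOrder ComplexConjugate

/-- The symmetrization map `π_n : ℂⁿ → ℂⁿ`. The coordinate with (zero-based) index `j` is the
elementary symmetric polynomial of degree `j + 1`, the sum over all `(j + 1)`-element sets of
indices `i₁ < ⋯ < i_{j+1}` of the products of the corresponding `z i`. -/
def symmetrization (n : ℕ) (z : Fin n → ℂ) : Fin n → ℂ := fun j =>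
  ∑ t ∈ Finset.powersetCard ((j : ℕ) + 1) (Finset.univ : Finset (Fin n)), ∏ i ∈ t, z i

/-- The open symmetrized polydisc `𝔾_n`, the image of `𝔻ⁿ` under the symmetrization map. -/
def openSymPolydisc (n : ℕ) : Set (Fin n → ℂ) :=
  {w | ∃ z : Fin n → ℂ, (∀ i, ‖z i‖ < 1) ∧ symmetrization n z = w}

/-- For `w = (s_1, …, s_{n-1}, p)`, the numbers `s_0 = 1`, `s_1, …, s_{n-1}`, `s_n = p`
(only indices `k ≤ n` are ever used). -/
def extCoord {n : ℕ} (w : Fin n → ℂ) (k : ℕ) : ℂ :=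
  if k = 0 then 1 else if h : k - 1 < n then w ⟨k - 1, h⟩ else 0

/-- The `n × n` matrix attached to `w = (s_1, …, s_{n-1}, p)`. With `s_0 = 1` and `s_n = p`, its
entry in row `k` and column `l`, for `1 ≤ k, l ≤ n`, is
`(-1)^(k+l) * ∑_{j=1}^{min(k,l)} (conj s_{k-j} * s_{l-j} - s_{n-k+j} * conj s_{n-l+j})`.
Below `k`, `l` and `j` are all shifted by one, which changes none of the exponents' parities
or the indices. -/
noncomputable def symPolydiscMatrix {n : ℕ} (w : Fin n → ℂ) : Matrix (Fin n) (Fin n) ℂ :=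
  Matrix.of fun k l =>
    (-1 : ℂ) ^ ((k : ℕ) + (l : ℕ)) *
      ∑ j ∈ Finset.range (min (k : ℕ) (l : ℕ) + 1),
        (conj (extCoord w (k - j)) * extCoord w (l - j)
          - extCoord w (n - k + j) * conj (extCoord w (n - l + j)))

/-! The equivalence of (i) and (iii) is the Schur–Cohn criterion. For roots `z_i`, put `P = ∏ (1 -
z_i X)` and `Q = ∏ (X - conj z_i)`; by Vieta `M = T_P* T_P - T_Q* T_Q` with Toeplitz matrices, so
its quadratic form is a difference of shift energies. Turning factors `1 - z X` into `X - conj z`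
one at a time (`shiftEnergy_factor_sub`) writes it as `∑ (1 - |z_i|²) |φ(R_i)|²`, with `R_i` a mixed
product of degree below `n`. If all roots lie in the disc, the form is nonnegative and the `R_i`
span the polynomials of degree below `n`, so it is definite. If a root lies outside, peel it first
and choose `φ ≠ 0` killing the other `n - 1` terms: the form is not positive. For (ii), substituting
`β` gives `M(s, p) = (1 - |p|²) M(β, 0)`, and a zero last coordinate means one extra root `0`. -/

open Polynomial in
/-- The product of the factors `1 - z X` over a multiset of complex numbers. -/
noncomputable def reversedProd (l : Multiset ℂ) : ℂ[X] :=
  (l.map fun z => 1 - C z * X).prod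

open Polynomial in
/-- The product of the factors `X - conj z` over a multiset of complex numbers. -/
noncomputable def conjProd (l : Multiset ℂ) : ℂ[X] :=
  (l.map fun z => X - C (conj z)).prod

open Polynomial in
/-- The square sum of the values of a functional at `P, X P, …, X ^ (n - 1) P`. -/
noncomputable def shiftEnergy (n : ℕ) (φ : ℂ[X] →ₗ[ℂ] ℂ) (P : ℂ[X]) : ℝ :=
  ∑ j ∈ Finset.range n, Complex.normSq (φ (X ^ j * P))

open Polynomial in
/-- The functional `g ↦ φ ((X - conj z) * g)`. -/
noncomputable def mulConjFactor (z : ℂ) (φ : ℂ[X] →ₗ[ℂ] ℂ) : ℂ[X] →ₗ[ℂ] ℂ :=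
  φ ∘ₗ LinearMap.mulLeft ℂ (X - C (conj z))

/-! ### Shift energies and peeling off one root. -/

section ShiftEnergy

open Polynomial

theorem reversedProd_cons (z : ℂ) (l : Multiset ℂ) :
    reversedProd (z ::ₘ l) = (1 - C z * X) * reversedProd l := by
  simp [reversedProd]

theorem conjProd_cons (z : ℂ) (l : Multiset ℂ) :
    conjProd (z ::ₘ l) = (X - C (conj z)) * conjProd l := by
  simp [conjProd]

theorem mulConjFactor_apply (z : ℂ) (φ : ℂ[X] →ₗ[ℂ] ℂ) (g : ℂ[X]) :
    mulConjFactor z φ g = φ ((X - C (conj z)) * g) := rfl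

theorem mulConjFactor_X_pow_mul {n : ℕ} {φ : ℂ[X] →ₗ[ℂ] ℂ} (hφ : ∀ g, φ (X ^ n * g) = 0)
    (z : ℂ) (g : ℂ[X]) : mulConjFactor z φ (X ^ n * g) = 0 := by
  rw [mulConjFactor_apply, mul_left_comm, hφ]

theorem shiftEnergy_mulConjFactor (n : ℕ) (φ : ℂ[X] →ₗ[ℂ] ℂ) (z : ℂ) (P : ℂ[X]) :
    shiftEnergy n (mulConjFactor z φ) P = shiftEnergy n φ ((X - C (conj z)) * P) := by
  simp only [shiftEnergy, mulConjFactor_apply, mul_left_comm]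

theorem map_C_mul (φ : ℂ[X] →ₗ[ℂ] ℂ) (c : ℂ) (P : ℂ[X]) : φ (C c * P) = c * φ P := by
  rw [← smul_eq_C_mul, map_smul, smul_eq_mul]

/-- With `a = φ(X^j P)` and `b = φ(X^(j+1) P)`, the cross terms of `|a - z b|²` and `|b - conj z
a|²` agree, leaving `(1 - |z|²)(|a|² - |b|²)`. The sum over `j` telescopes, and `hφ` kills the far
end. -/
theorem shiftEnergy_factor_sub {n : ℕ} {φ : ℂ[X] →ₗ[ℂ] ℂ} (hφ : ∀ g, φ (X ^ n * g) = 0)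
    (z : ℂ) (P : ℂ[X]) :
    shiftEnergy n φ ((1 - C z * X) * P) - shiftEnergy n φ ((X - C (conj z)) * P) =
      (1 - Complex.normSq z) * Complex.normSq (φ P) := by
  have h : ∀ j, Complex.normSq (φ (X ^ j * ((1 - C z * X) * P))) -
      Complex.normSq (φ (X ^ j * ((X - C (conj z)) * P))) =
      (1 - Complex.normSq z) * (Complex.normSq (φ (X ^ j * P)) -
        Complex.normSq (φ (X ^ (j + 1) * P))) := by
    intro j
    have h1 : X ^ j * ((1 - C z * X) * P) = X ^ j * P - C z * (X ^ (j + 1) * P) := by ring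
    have h2 : X ^ j * ((X - C (conj z)) * P) =
        X ^ (j + 1) * P - C (conj z) * (X ^ j * P) := by ring
    rw [h1, h2, LinearMap.map_sub, LinearMap.map_sub, map_C_mul, map_C_mul]
    simp only [Complex.normSq_apply, Complex.sub_re, Complex.sub_im, Complex.mul_re,
      Complex.mul_im, Complex.conj_re, Complex.conj_im]
    ring
  rw [shiftEnergy, shiftEnergy, ← Finset.sum_sub_distrib, Finset.sum_congr rfl fun j _ => h j,
    ← Finset.mul_sum, Finset.sum_range_sub', hφ]
  simp

theorem shiftEnergy_cons_sub {n : ℕ} {φ : ℂ[X] →ₗ[ℂ] ℂ} (hφ : ∀ g, φ (X ^ n * g) = 0)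
    (z : ℂ) (l : Multiset ℂ) :
    shiftEnergy n φ (reversedProd (z ::ₘ l)) - shiftEnergy n φ (conjProd (z ::ₘ l)) =
      (1 - Complex.normSq z) * Complex.normSq (φ (reversedProd l)) +
        (shiftEnergy n (mulConjFactor z φ) (reversedProd l) -
          shiftEnergy n (mulConjFactor z φ) (conjProd l)) := by
  rw [reversedProd_cons, conjProd_cons, shiftEnergy_mulConjFactor, shiftEnergy_mulConjFactor,
    ← shiftEnergy_factor_sub hφ]
  ring

theorem normSq_lt_one {z : ℂ} (hz : ‖z‖ < 1) : Complex.normSq z < 1 := by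
  rw [Complex.normSq_eq_norm_sq]
  exact pow_lt_one₀ (norm_nonneg z) hz two_ne_zero

theorem eval_reversedProd_ne_zero {l : Multiset ℂ} (hl : ∀ z ∈ l, ‖z‖ < 1) {a : ℂ}
    (ha : ‖a‖ < 1) : (reversedProd l).eval a ≠ 0 := by
  induction l using Multiset.induction with
  | empty => simp [reversedProd]
  | cons z l ih =>
    rw [reversedProd_cons, eval_mul]
    refine mul_ne_zero ?_ (ih fun w hw => hl w (Multiset.mem_cons_of_mem hw))
    have hz := hl z (Multiset.mem_cons_self z l)
    have : ‖z * a‖ < 1 := by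
      rw [norm_mul]
      exact mul_lt_one_of_nonneg_of_lt_one_left (norm_nonneg z) hz ha.le
    intro h
    simp only [eval_sub, eval_one, eval_mul, eval_C, eval_X] at h
    rw [← sub_eq_zero.mp h] at this
    simp at this

theorem natDegree_reversedProd_le (l : Multiset ℂ) :
    (reversedProd l).natDegree ≤ Multiset.card l := by
  induction l using Multiset.induction with
  | empty => simp [reversedProd]
  | cons z l ih =>
    rw [reversedProd_cons, Multiset.card_cons, add_comm]
    refine natDegree_mul_le.trans (add_le_add ?_ ih)
    compute_degree

theorem shiftEnergy_sub_nonneg {n : ℕ} {l : Multiset ℂ} (hl : ∀ z ∈ l, ‖z‖ < 1) :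
    ∀ {φ : ℂ[X] →ₗ[ℂ] ℂ}, (∀ g, φ (X ^ n * g) = 0) →
      0 ≤ shiftEnergy n φ (reversedProd l) - shiftEnergy n φ (conjProd l) := by
  induction l using Multiset.induction with
  | empty => simp [reversedProd, conjProd]
  | cons z l ih =>
    intro φ hφ
    rw [shiftEnergy_cons_sub hφ]
    have hz := normSq_lt_one (hl z (Multiset.mem_cons_self z l))
    exact add_nonneg (mul_nonneg (by linarith) (Complex.normSq_nonneg _))
      (ih (fun w hw => hl w (Multiset.mem_cons_of_mem hw)) (mulConjFactor_X_pow_mul hφ z))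

/-- If the energies agree for a multiset in the open unit disc, the functional vanishes on all
polynomials of degree less than the cardinality. -/
theorem map_eq_zero_of_shiftEnergy_eq {n : ℕ} {l : Multiset ℂ} (hl : ∀ z ∈ l, ‖z‖ < 1) :
    ∀ {φ : ℂ[X] →ₗ[ℂ] ℂ}, (∀ g, φ (X ^ n * g) = 0) →
      shiftEnergy n φ (reversedProd l) - shiftEnergy n φ (conjProd l) = 0 →
      ∀ g : ℂ[X], g.degree < Multiset.card l → φ g = 0 := by
  induction l using Multiset.induction with
  | empty =>
    intro φ _ _ g hg
    have : g = 0 := by simpa using hg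
    simp [this]
  | cons z l ih =>
    intro φ hφ h g hg
    have hl' : ∀ w ∈ l, ‖w‖ < 1 := fun w hw => hl w (Multiset.mem_cons_of_mem hw)
    have hz := hl z (Multiset.mem_cons_self z l)
    have hz' := normSq_lt_one hz
    have hφ' := mulConjFactor_X_pow_mul hφ z
    rw [shiftEnergy_cons_sub hφ] at h
    have h1 := mul_nonneg (by linarith : 0 ≤ 1 - Complex.normSq z)
      (Complex.normSq_nonneg (φ (reversedProd l)))
    have h2 := shiftEnergy_sub_nonneg hl' hφ'
    have h3 : φ (reversedProd l) = 0 := by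
      have : (1 - Complex.normSq z) * Complex.normSq (φ (reversedProd l)) = 0 := by linarith
      rcases mul_eq_zero.mp this with h0 | h0
      · linarith
      · exact Complex.normSq_eq_zero.mp h0
    have h4 := ih hl' hφ' (by linarith)
    have he : (reversedProd l).eval (conj z) ≠ 0 :=
      eval_reversedProd_ne_zero hl' (by rwa [RCLike.norm_conj])
    -- Modulo `reversedProd l`, on which `φ` vanishes, `g` becomes a multiple of `X - conj z`; the
    -- induction hypothesis handles the quotient.
    obtain ⟨c, hc⟩ : ∃ c, c * (reversedProd l).eval (conj z) = g.eval (conj z) :=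
      ⟨_, div_mul_cancel₀ _ he⟩
    have hroot : (g - C c * reversedProd l).IsRoot (conj z) := by
      simp [IsRoot, hc]
    obtain ⟨r, hr⟩ := dvd_iff_isRoot.mpr hroot
    have hdeg : r.degree < Multiset.card l := by
      have h5 : (g - C c * reversedProd l).degree < (Multiset.card l + 1 : ℕ) := by
        refine (degree_sub_le _ _).trans_lt (max_lt (by simpa using hg) ?_)
        refine (degree_le_of_natDegree_le
          ((natDegree_C_mul_le c _).trans (natDegree_reversedProd_le l))).trans_lt ?_
        exact_mod_cast Nat.lt_succ_self _
      by_cases hr0 : r = 0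
      · simp [hr0, bot_lt_iff_ne_bot]
      · rw [hr, degree_mul, degree_X_sub_C, degree_eq_natDegree hr0] at h5
        rw [degree_eq_natDegree hr0]
        norm_cast at h5 ⊢
        omega
    have h6 := h4 r hdeg
    rw [mulConjFactor_apply, ← hr, map_sub, map_C_mul, h3] at h6
    simpa using h6

/-- The energies of the two products agree on a subspace cut out by `card l` linear conditions. -/
theorem exists_list_shiftEnergy_eq (n : ℕ) (l : Multiset ℂ) :
    ∃ L : List ℂ[X], L.length = Multiset.card l ∧
      ∀ φ : ℂ[X] →ₗ[ℂ] ℂ, (∀ g, φ (X ^ n * g) = 0) → (∀ P ∈ L, φ P = 0) →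
        shiftEnergy n φ (reversedProd l) - shiftEnergy n φ (conjProd l) = 0 := by
  induction l using Multiset.induction with
  | empty => exact ⟨[], by simp [reversedProd, conjProd]⟩
  | cons z l ih =>
    obtain ⟨L, hL, h⟩ := ih
    refine ⟨reversedProd l :: L.map fun P => (X - C (conj z)) * P, by simp [hL], ?_⟩
    intro φ hφ hP
    rw [shiftEnergy_cons_sub hφ, hP _ List.mem_cons_self,
      h _ (mulConjFactor_X_pow_mul hφ z) fun P hPL =>
        hP _ (List.mem_cons_of_mem _ (List.mem_map_of_mem hPL))]
    simp

end ShiftEnergy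

/-! ### The Schur–Cohn criterion. -/

section CoeffFunctional

open Polynomial

/-- The functional pairing the first `n` coefficients of a polynomial with a vector. -/
noncomputable def coeffFunctional (n : ℕ) : (Fin n → ℂ) →ₗ[ℂ] ℂ[X] →ₗ[ℂ] ℂ :=
  ∑ k : Fin n, (LinearMap.proj k).smulRight (lcoeff ℂ (k : ℕ))

theorem coeffFunctional_apply {n : ℕ} (x : Fin n → ℂ) (g : ℂ[X]) :
    coeffFunctional n x g = ∑ k : Fin n, g.coeff k * x k := by
  simp [coeffFunctional, mul_comm]

theorem coeffFunctional_X_pow_mul {n : ℕ} (x : Fin n → ℂ) (g : ℂ[X]) :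
    coeffFunctional n x (X ^ n * g) = 0 := by
  rw [coeffFunctional_apply]
  refine Finset.sum_eq_zero fun k _ => ?_
  rw [coeff_X_pow_mul', if_neg (not_le.mpr k.isLt), zero_mul]

theorem coeffFunctional_X_pow {n : ℕ} (x : Fin n → ℂ) (k : Fin n) :
    coeffFunctional n x (X ^ (k : ℕ)) = x k := by
  rw [coeffFunctional_apply, Finset.sum_eq_single k]
  · simp
  · intro j _ hj
    simp [coeff_X_pow, Fin.val_inj, hj]
  · simp

/-- The Schur–Cohn criterion for a multiset of roots, in terms of shift energies. -/
theorem forall_norm_lt_one_iff_shiftEnergy {n : ℕ} {l : Multiset ℂ} (hn : Multiset.card l = n) :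
    (∀ z ∈ l, ‖z‖ < 1) ↔ ∀ x : Fin n → ℂ, x ≠ 0 →
      0 < shiftEnergy n (coeffFunctional n x) (reversedProd l) -
        shiftEnergy n (coeffFunctional n x) (conjProd l) := by
  constructor
  · intro hl x hx
    refine lt_of_le_of_ne (shiftEnergy_sub_nonneg hl (coeffFunctional_X_pow_mul x)) fun h => hx ?_
    ext k
    rw [← coeffFunctional_X_pow x k]
    refine map_eq_zero_of_shiftEnergy_eq hl (coeffFunctional_X_pow_mul x) h.symm _ ?_
    rw [degree_X_pow, hn]
    exact_mod_cast k.isLt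
  · intro h z hz
    obtain ⟨t, rfl⟩ := Multiset.exists_cons_of_mem hz
    obtain ⟨L, hL, hLt⟩ := exists_list_shiftEnergy_eq n t
    let f : (Fin n → ℂ) →ₗ[ℂ] (Fin L.length → ℂ) := LinearMap.pi fun i =>
      (LinearMap.applyₗ ((X - C (conj z)) * L.get i)) ∘ₗ coeffFunctional n
    -- There are only `n - 1` conditions on `n` unknowns.
    have hf : LinearMap.ker f ≠ ⊥ := by
      apply LinearMap.ker_ne_bot_of_finrank_lt
      simp only [Module.finrank_fin_fun, hL]
      simp only [Multiset.card_cons] at hn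
      omega
    obtain ⟨x, hx, hx0⟩ := (Submodule.ne_bot_iff _).mp hf
    have hpos := h x hx0
    have hzero : ∀ P ∈ L, mulConjFactor z (coeffFunctional n x) P = 0 := by
      intro P hP
      obtain ⟨i, rfl⟩ := List.get_of_mem hP
      exact congrFun (LinearMap.mem_ker.mp hx) i
    rw [shiftEnergy_cons_sub (coeffFunctional_X_pow_mul x),
      hLt _ (mulConjFactor_X_pow_mul (coeffFunctional_X_pow_mul x) z) hzero, add_zero] at hpos
    have h1 := pos_of_mul_pos_left hpos (Complex.normSq_nonneg _)
    rw [Complex.normSq_eq_norm_sq] at h1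
    nlinarith [norm_nonneg z]

end CoeffFunctional

/-! ### Elementary symmetric functions as coefficients. -/

section Vieta

open Polynomial

theorem Multiset.esymm_cons_succ {R : Type*} [CommSemiring R] (z : R) (l : Multiset R) (k : ℕ) :
    (z ::ₘ l).esymm (k + 1) = l.esymm (k + 1) + z * l.esymm k := by
  simp [Multiset.esymm, Multiset.powersetCard_cons, Multiset.sum_map_mul_left]

theorem Multiset.esymm_zero_right {R : Type*} [CommSemiring R] (l : Multiset R) :
    l.esymm 0 = 1 := by
  simp [Multiset.esymm]

theorem Multiset.esymm_zero_cons {R : Type*} [CommSemiring R] (l : Multiset R) (k : ℕ) :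
    ((0 : R) ::ₘ l).esymm k = l.esymm k := by
  cases k with
  | zero => rw [Multiset.esymm_zero_right, Multiset.esymm_zero_right]
  | succ k => rw [Multiset.esymm_cons_succ, zero_mul, add_zero]

theorem Multiset.esymm_card {R : Type*} [CommSemiring R] (l : Multiset R) :
    l.esymm (Multiset.card l) = l.prod := by
  simp [Multiset.esymm]

theorem Multiset.esymm_eq_zero_of_card_lt {R : Type*} [CommSemiring R] {l : Multiset R} {k : ℕ}
    (h : Multiset.card l < k) : l.esymm k = 0 := by
  simp [Multiset.esymm, Multiset.powersetCard_eq_empty k h]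

theorem Multiset.esymm_map_conj (l : Multiset ℂ) (k : ℕ) :
    (l.map fun z => conj z).esymm k = conj (l.esymm k) := by
  induction l using Multiset.induction generalizing k with
  | empty => cases k <;> simp [Multiset.esymm, Multiset.powersetCard_zero_right]
  | cons z l ih =>
    cases k with
    | zero => simp [Multiset.esymm_zero_right]
    | succ k => rw [Multiset.map_cons, Multiset.esymm_cons_succ, Multiset.esymm_cons_succ, ih, ih,
        _root_.map_add, _root_.map_mul]

theorem coeff_reversedProd (l : Multiset ℂ) (k : ℕ) :
    (reversedProd l).coeff k = (-1) ^ k * l.esymm k := by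
  induction l using Multiset.induction generalizing k with
  | empty => cases k <;> simp [reversedProd, Multiset.esymm, Multiset.powersetCard_zero_right,
      coeff_one]
  | cons z l ih =>
    rw [reversedProd_cons, sub_mul, one_mul, mul_assoc, coeff_sub, coeff_C_mul]
    cases k with
    | zero => simp [ih, Multiset.esymm_zero_right]
    | succ k =>
      rw [coeff_X_mul, ih, ih, Multiset.esymm_cons_succ]
      ring

theorem coeff_conjProd {l : Multiset ℂ} {k : ℕ} (h : k ≤ Multiset.card l) :
    (conjProd l).coeff k =
      (-1) ^ (Multiset.card l - k) * conj (l.esymm (Multiset.card l - k)) := by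
  have := Multiset.prod_X_sub_C_coeff (l.map fun z => conj z) (k := k) (by simpa using h)
  rw [Multiset.map_map, Multiset.esymm_map_conj, Multiset.card_map] at this
  exact this

/-- Every sequence starting with `1` consists, up to index `n`, of the elementary symmetric
functions of some multiset of `n` complex numbers. -/
theorem exists_multiset_esymm_eq (n : ℕ) (e : ℕ → ℂ) (he : e 0 = 1) :
    ∃ l : Multiset ℂ, Multiset.card l = n ∧ ∀ k ≤ n, l.esymm k = e k := by
  let f : ℂ[X] := ∑ j ∈ Finset.range (n + 1), C ((-1) ^ (n - j) * e (n - j)) * X ^ j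
  have hc : ∀ j ≤ n, f.coeff j = (-1) ^ (n - j) * e (n - j) := by
    intro j hj
    simp only [f, finsetSum_coeff, coeff_C_mul_X_pow]
    rw [Finset.sum_ite_eq, if_pos (by simpa [Nat.lt_succ_iff] using hj)]
  have hn : f.coeff n = 1 := by simp [hc n le_rfl, he]
  have hdeg : f.natDegree = n := by
    refine le_antisymm (natDegree_sum_le_of_forall_le _ _ fun j hj => ?_)
      (le_natDegree_of_ne_zero (by simp [hn]))
    exact (natDegree_C_mul_X_pow_le _ _).trans (Nat.lt_succ_iff.mp (Finset.mem_range.mp hj))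
  have hlead : f.leadingCoeff = 1 := by rw [leadingCoeff, hdeg, hn]
  have hs : f.Splits := IsAlgClosed.splits f
  refine ⟨f.roots, by rw [← hs.natDegree_eq_card_roots, hdeg], fun k hk => ?_⟩
  have h := coeff_eq_esymm_roots_of_splits hs (k := n - k) (by rw [hdeg]; omega)
  rw [hc _ (Nat.sub_le n k), hlead, one_mul, hdeg, Nat.sub_sub_self hk] at h
  exact (mul_left_cancel₀ (pow_ne_zero k (neg_ne_zero.mpr one_ne_zero)) h).symm

end Vieta

/-! ### The symmetrized polydisc via multisets of roots. -/

section ExtCoord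

theorem extCoord_zero {n : ℕ} (w : Fin n → ℂ) : extCoord w 0 = 1 := by simp [extCoord]

theorem extCoord_succ {n : ℕ} (w : Fin n → ℂ) (i : Fin n) : extCoord w (i + 1) = w i := by
  simp [extCoord]

theorem extCoord_eq_zero {n : ℕ} (w : Fin n → ℂ) {k : ℕ} (hk : n < k) : extCoord w k = 0 := by
  simp only [extCoord]
  rw [if_neg (by omega), dif_neg (by omega)]

theorem symmetrization_apply {n : ℕ} (z : Fin n → ℂ) (j : Fin n) :
    symmetrization n z j = (Finset.univ.val.map z).esymm (j + 1) := by
  rw [Finset.esymm_map_val]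
  rfl

theorem extCoord_symmetrization {n : ℕ} (z : Fin n → ℂ) (k : ℕ) :
    extCoord (symmetrization n z) k = (Finset.univ.val.map z).esymm k := by
  rcases Nat.eq_zero_or_pos k with rfl | hk
  · rw [extCoord_zero, Multiset.esymm_zero_right]
  · rcases le_or_gt k n with hkn | hkn
    · obtain ⟨i, rfl⟩ : ∃ i : Fin n, k = i + 1 := ⟨⟨k - 1, by omega⟩, by simp; omega⟩
      rw [extCoord_succ, symmetrization_apply]
    · rw [extCoord_eq_zero _ hkn, Multiset.esymm_eq_zero_of_card_lt (by simpa using hkn)]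

theorem mem_openSymPolydisc_iff {n : ℕ} {w : Fin n → ℂ} :
    w ∈ openSymPolydisc n ↔ ∃ l : Multiset ℂ, Multiset.card l = n ∧ (∀ z ∈ l, ‖z‖ < 1) ∧
      ∀ k ≤ n, extCoord w k = l.esymm k := by
  constructor
  · rintro ⟨z, hz, rfl⟩
    exact ⟨Finset.univ.val.map z, by simp, by simpa using hz,
      fun k _ => extCoord_symmetrization z k⟩
  · rintro ⟨l, rfl, hl, h⟩
    obtain ⟨z, hz⟩ : ∃ z : Fin (Multiset.card l) → ℂ, Finset.univ.val.map z = l := by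
      have hL : l.toList.length = Multiset.card l := Multiset.length_toList l
      refine ⟨fun i => l.toList.get (i.cast hL.symm), ?_⟩
      rw [Fin.univ_val_map, ← List.ofFn_congr hL, List.ofFn_get, Multiset.coe_toList]
    refine ⟨z, fun i => hl _ ?_, funext fun j => ?_⟩
    · rw [← hz]
      exact Multiset.mem_map_of_mem z (Finset.mem_univ_val i)
    · rw [symmetrization_apply, hz, ← h _ j.isLt, extCoord_succ]

theorem snoc_zero_mem_openSymPolydisc_iff {m : ℕ} {β : Fin m → ℂ} :
    (Fin.snoc (α := fun _ => ℂ) β 0 : Fin (m + 1) → ℂ) ∈ openSymPolydisc (m + 1) ↔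
      β ∈ openSymPolydisc m := by
  have hlast : extCoord (Fin.snoc (α := fun _ => ℂ) β 0 : Fin (m + 1) → ℂ) (m + 1) = 0 := by
    have := extCoord_succ (Fin.snoc (α := fun _ => ℂ) β 0 : Fin (m + 1) → ℂ) (Fin.last m)
    simpa using this
  have hlt : ∀ k ≤ m, extCoord (Fin.snoc (α := fun _ => ℂ) β 0 : Fin (m + 1) → ℂ) k =
      extCoord β k := by
    intro k hk
    rcases Nat.eq_zero_or_pos k with rfl | hk0
    · rw [extCoord_zero, extCoord_zero]
    · obtain ⟨i, rfl⟩ : ∃ i : Fin m, k = i + 1 := ⟨⟨k - 1, by omega⟩, by simp; omega⟩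
      have := extCoord_succ (Fin.snoc (α := fun _ => ℂ) β 0 : Fin (m + 1) → ℂ) i.castSucc
      rw [Fin.snoc_castSucc] at this
      rw [extCoord_succ]
      exact this
  rw [mem_openSymPolydisc_iff, mem_openSymPolydisc_iff]
  constructor
  · rintro ⟨l, hl, hnorm, h⟩
    have h0 := h (m + 1) le_rfl
    rw [hlast, ← hl, Multiset.esymm_card] at h0
    -- The last coordinate is the product of the roots, so some root is `0`.
    obtain ⟨t, rfl⟩ := Multiset.exists_cons_of_mem (Multiset.prod_eq_zero_iff.mp h0.symm)
    refine ⟨t, by simpa using hl, fun z hz => hnorm z (Multiset.mem_cons_of_mem hz), ?_⟩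
    intro k hk
    rw [← hlt k hk, h k (by omega), Multiset.esymm_zero_cons]
  · rintro ⟨t, ht, hnorm, h⟩
    refine ⟨0 ::ₘ t, by simp [ht], ?_, ?_⟩
    · intro z hz
      rcases Multiset.mem_cons.mp hz with rfl | hz
      · simp
      · exact hnorm z hz
    · intro k hk
      rw [Multiset.esymm_zero_cons]
      rcases Nat.lt_or_ge m k with hk' | hk'
      · obtain rfl : k = m + 1 := by omega
        rw [hlast, Multiset.esymm_eq_zero_of_card_lt (by omega)]
      · rw [hlt k hk', h k hk']

end ExtCoord

/-! ### Toeplitz factorization of the matrix. -/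

section Matrix

open Polynomial Matrix

/-- The upper triangular Toeplitz matrix with row `j` the first `n` coefficients of `X ^ j * P`. -/
noncomputable def toeplitz (n : ℕ) (P : ℂ[X]) : Matrix (Fin n) (Fin n) ℂ :=
  Matrix.of fun j k => (X ^ (j : ℕ) * P).coeff k

theorem toeplitz_mulVec {n : ℕ} (P : ℂ[X]) (x : Fin n → ℂ) (j : Fin n) :
    (toeplitz n P *ᵥ x) j = coeffFunctional n x (X ^ (j : ℕ) * P) := by
  rw [coeffFunctional_apply]
  rfl

theorem star_dotProduct_toeplitz {n : ℕ} (P : ℂ[X]) (x : Fin n → ℂ) :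
    star x ⬝ᵥ (((toeplitz n P)ᴴ * toeplitz n P) *ᵥ x) =
      (shiftEnergy n (coeffFunctional n x) P : ℂ) := by
  rw [← mulVec_mulVec, dotProduct_mulVec, vecMul_conjTranspose, star_star, shiftEnergy,
    ← Fin.sum_univ_eq_sum_range (fun j => Complex.normSq (coeffFunctional n x (X ^ j * P)))]
  push_cast
  refine Finset.sum_congr rfl fun j _ => ?_
  rw [Pi.star_apply, toeplitz_mulVec, Complex.normSq_eq_conj_mul_self]
  rfl

theorem conjTranspose_toeplitz_mul_apply {n : ℕ} (P : ℂ[X]) (k l : Fin n) :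
    ((toeplitz n P)ᴴ * toeplitz n P) k l =
      ∑ j ∈ Finset.range (min (k : ℕ) (l : ℕ) + 1), conj (P.coeff (k - j)) * P.coeff (l - j) := by
  rw [Matrix.mul_apply]
  simp only [conjTranspose_apply, toeplitz, Matrix.of_apply, coeff_X_pow_mul']
  rw [Fin.sum_univ_eq_sum_range
    (fun j => star (if j ≤ (k : ℕ) then P.coeff (k - j) else 0) *
      (if j ≤ (l : ℕ) then P.coeff (l - j) else 0))]
  symm
  refine Finset.sum_subset_zero_on_sdiff ?_ ?_ ?_
  · intro j hj
    rw [Finset.mem_range] at hj ⊢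
    omega
  · intro j hj
    simp only [Finset.mem_sdiff, Finset.mem_range] at hj
    by_cases hk : j ≤ (k : ℕ)
    · rw [if_neg (show ¬ j ≤ (l : ℕ) by omega), mul_zero]
    · rw [if_neg hk, star_zero, zero_mul]
  · intro j hj
    rw [Finset.mem_range] at hj
    rw [if_pos (by omega), if_pos (by omega)]
    rfl

theorem symPolydiscMatrix_eq_toeplitz {n : ℕ} {w : Fin n → ℂ} {l : Multiset ℂ}
    (hl : Multiset.card l = n) (h : ∀ k ≤ n, extCoord w k = l.esymm k) :
    symPolydiscMatrix w = (toeplitz n (reversedProd l))ᴴ * toeplitz n (reversedProd l) -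
      (toeplitz n (conjProd l))ᴴ * toeplitz n (conjProd l) := by
  ext a b
  have ha := a.isLt
  have hb := b.isLt
  rw [Matrix.sub_apply, conjTranspose_toeplitz_mul_apply, conjTranspose_toeplitz_mul_apply,
    ← Finset.sum_sub_distrib, symPolydiscMatrix, Matrix.of_apply, Finset.mul_sum]
  refine Finset.sum_congr rfl fun j hj => ?_
  rw [Finset.mem_range] at hj
  have sign : ∀ {c d : ℕ}, Even (c + d + ((a : ℕ) + b)) →
      (-1 : ℂ) ^ ((a : ℕ) + b) = (-1) ^ c * (-1) ^ d := by
    intro c d hcd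
    rw [← pow_add]
    exact neg_one_pow_congr (by rw [Nat.even_add] at hcd; tauto)
  rw [coeff_reversedProd, coeff_reversedProd, coeff_conjProd (by omega), coeff_conjProd (by omega),
    hl, show n - ((a : ℕ) - j) = n - a + j by omega, show n - ((b : ℕ) - j) = n - b + j by omega,
    h _ (by omega), h _ (by omega), h _ (by omega), h _ (by omega), mul_sub]
  simp only [map_mul, map_pow, map_neg, map_one, Complex.conj_conj]
  congr 1
  · rw [sign (c := a - j) (d := b - j) (by rw [Nat.even_iff]; omega)]
    ring
  · rw [sign (c := n - a + j) (d := n - b + j) (by rw [Nat.even_iff]; omega)]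
    ring

theorem mem_openSymPolydisc_iff_posDef {n : ℕ} {w : Fin n → ℂ} :
    w ∈ openSymPolydisc n ↔ (symPolydiscMatrix w).PosDef := by
  have key : ∀ l : Multiset ℂ, Multiset.card l = n → (∀ k ≤ n, extCoord w k = l.esymm k) →
      ((∀ z ∈ l, ‖z‖ < 1) ↔ (symPolydiscMatrix w).PosDef) := by
    intro l hl h
    rw [forall_norm_lt_one_iff_shiftEnergy hl, posDef_iff_dotProduct_mulVec,
      symPolydiscMatrix_eq_toeplitz hl h]
    simp only [sub_mulVec, dotProduct_sub, star_dotProduct_toeplitz]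
    refine ⟨fun hx => ⟨(isHermitian_conjTranspose_mul_self _).sub
      (isHermitian_conjTranspose_mul_self _), fun x hx0 => ?_⟩, fun hx x hx0 => ?_⟩
    · exact_mod_cast hx x hx0
    · exact_mod_cast hx.2 hx0
  constructor
  · intro hw
    obtain ⟨l, hl, hnorm, h⟩ := mem_openSymPolydisc_iff.mp hw
    exact (key l hl h).mp hnorm
  · intro hM
    -- Any `w` comes from some roots in `ℂ`; definiteness then locates them.
    obtain ⟨l, hl, h⟩ := exists_multiset_esymm_eq n (extCoord w) (extCoord_zero w)
    have h' : ∀ k ≤ n, extCoord w k = l.esymm k := fun k hk => (h k hk).symm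
    exact mem_openSymPolydisc_iff.mpr ⟨l, hl, (key l hl h').mpr hM, h'⟩

/-! ### Passing from `(s, p)` to `β`. -/

theorem extCoord_snoc_eq {m : ℕ} {s β : Fin m → ℂ} {p : ℂ}
    (h : ∀ i : Fin m, s i = β i + conj (β (Fin.rev i)) * p) {k : ℕ} (hk : k ≤ m + 1) :
    extCoord (Fin.snoc (α := fun _ => ℂ) s p : Fin (m + 1) → ℂ) k =
      extCoord (Fin.snoc (α := fun _ => ℂ) β 0 : Fin (m + 1) → ℂ) k +
        conj (extCoord (Fin.snoc (α := fun _ => ℂ) β 0 : Fin (m + 1) → ℂ) (m + 1 - k)) * p := by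
  have hlast : ∀ (t : Fin m → ℂ) (c : ℂ),
      extCoord (Fin.snoc (α := fun _ => ℂ) t c : Fin (m + 1) → ℂ) (m + 1) = c := by
    intro t c
    simpa using extCoord_succ (Fin.snoc (α := fun _ => ℂ) t c : Fin (m + 1) → ℂ) (Fin.last m)
  have hmid : ∀ (t : Fin m → ℂ) (c : ℂ) (i : Fin m),
      extCoord (Fin.snoc (α := fun _ => ℂ) t c : Fin (m + 1) → ℂ) (i + 1) = t i := by
    intro t c i
    have := extCoord_succ (Fin.snoc (α := fun _ => ℂ) t c : Fin (m + 1) → ℂ) i.castSucc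
    rwa [Fin.snoc_castSucc] at this
  rcases Nat.eq_zero_or_pos k with rfl | hk0
  -- With `β_0 = 1` and `β_n = 0`, the relation persists at both ends: `1 = 1 + 0 * p`, and below `p
  -- = 0 + 1 * p`.
  · simp [extCoord_zero, hlast]
  · rcases Nat.lt_or_ge m k with hk' | hk'
    · obtain rfl : k = m + 1 := by omega
      simp [extCoord_zero, hlast]
    · obtain ⟨i, rfl⟩ : ∃ i : Fin m, k = i + 1 := ⟨⟨k - 1, by omega⟩, by simp; omega⟩
      rw [show m + 1 - ((i : ℕ) + 1) = (Fin.rev i : ℕ) + 1 by rw [Fin.val_rev]; omega, hmid, hmid,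
        hmid, h]

/-- Holds summand by summand: the terms linear in `p` or `conj p` cancel, and those in `|p|²` repeat
the constant ones with opposite sign. -/
theorem symPolydiscMatrix_snoc_eq_smul {m : ℕ} {s β : Fin m → ℂ} {p : ℂ}
    (h : ∀ i : Fin m, s i = β i + conj (β (Fin.rev i)) * p) :
    symPolydiscMatrix (Fin.snoc (α := fun _ => ℂ) s p : Fin (m + 1) → ℂ) =
      (1 - ‖p‖ ^ 2 : ℝ) •
        symPolydiscMatrix (Fin.snoc (α := fun _ => ℂ) β 0 : Fin (m + 1) → ℂ) := by
  ext a b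
  have ha := a.isLt
  have hb := b.isLt
  have hp : ((1 - ‖p‖ ^ 2 : ℝ) : ℂ) = 1 - p * conj p := by
    rw [Complex.mul_conj, Complex.normSq_eq_norm_sq]
    push_cast
    rfl
  rw [Matrix.smul_apply, Complex.real_smul, hp]
  simp only [symPolydiscMatrix, Matrix.of_apply]
  rw [mul_left_comm, Finset.mul_sum (a := 1 - p * conj p)]
  congr 1
  refine Finset.sum_congr rfl fun j hj => ?_
  rw [Finset.mem_range] at hj
  rw [extCoord_snoc_eq h (k := a - j) (by omega), extCoord_snoc_eq h (k := b - j) (by omega),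
    extCoord_snoc_eq h (k := m + 1 - a + j) (by omega),
    extCoord_snoc_eq h (k := m + 1 - b + j) (by omega),
    show m + 1 - ((a : ℕ) - j) = m + 1 - a + j by omega,
    show m + 1 - ((b : ℕ) - j) = m + 1 - b + j by omega,
    show m + 1 - (m + 1 - (a : ℕ) + j) = a - j by omega,
    show m + 1 - (m + 1 - (b : ℕ) + j) = b - j by omega]
  simp only [map_add, map_mul, Complex.conj_conj]
  ring

theorem posDef_snoc_iff {m : ℕ} {s β : Fin m → ℂ} {p : ℂ} (hp : ‖p‖ < 1)
    (h : ∀ i : Fin m, s i = β i + conj (β (Fin.rev i)) * p) :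
    (symPolydiscMatrix (Fin.snoc (α := fun _ => ℂ) s p : Fin (m + 1) → ℂ)).PosDef ↔
      β ∈ openSymPolydisc m := by
  have hpos : (0 : ℝ) < 1 - ‖p‖ ^ 2 := sub_pos.mpr (pow_lt_one₀ (norm_nonneg p) hp two_ne_zero)
  rw [← snoc_zero_mem_openSymPolydisc_iff, mem_openSymPolydisc_iff_posDef,
    symPolydiscMatrix_snoc_eq_smul h]
  refine ⟨fun hM => ?_, fun hM => hM.smul hpos⟩
  have := hM.smul (inv_pos.mpr hpos)
  rwa [smul_smul, inv_mul_cancel₀ hpos.ne', one_smul] at this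

end Matrix

theorem exists_eq_add_conj_rev_mul {m : ℕ} (s : Fin m → ℂ) {p : ℂ} (hp : ‖p‖ < 1) :
    ∃ β : Fin m → ℂ, ∀ i : Fin m, s i = β i + conj (β (Fin.rev i)) * p := by
  have hne : 1 - p * conj p ≠ 0 := by
    rw [Complex.mul_conj]
    exact_mod_cast (sub_pos.mpr (normSq_lt_one hp)).ne'
  -- Cramer's rule for the equation at `i` and the conjugate of the one at `Fin.rev i`.
  refine ⟨fun i => (s i - conj (s (Fin.rev i)) * p) / (1 - p * conj p), fun i => ?_⟩
  simp only [map_div₀, map_sub, map_mul, map_one, Complex.conj_conj, Fin.rev_rev]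
  rw [mul_comm (conj p) p]
  field_simp
  ring

/-- Here `n = m + 1 ≥ 2`; `s i` is `s_{i+1}` and `β i` is `β_{i+1}`, so that the partner
`β_{n-j}` of `β_j` is `β (Fin.rev i)` when `j = i + 1`. -/
theorem theorem3p2 (m : ℕ) (hm : 1 ≤ m) (s : Fin m → ℂ) (p : ℂ) (hp : ‖p‖ < 1) :
    List.TFAE [
      (Fin.snoc (α := fun _ => ℂ) s p : Fin (m + 1) → ℂ) ∈ openSymPolydisc (m + 1),
      ∃ β ∈ openSymPolydisc m, ∀ i : Fin m, s i = β i + conj (β (Fin.rev i)) * p,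
      (symPolydiscMatrix (Fin.snoc (α := fun _ => ℂ) s p : Fin (m + 1) → ℂ)).PosDef] := by
  tfae_have 1 ↔ 3 := mem_openSymPolydisc_iff_posDef
  tfae_have 2 → 3 := fun ⟨_, hβ, h⟩ => (posDef_snoc_iff hp h).mpr hβ
  tfae_have 3 → 2 := fun hM =>
    let ⟨β, h⟩ := exists_eq_add_conj_rev_mul s hp
    ⟨β, (posDef_snoc_iff hp h).mp hM, h⟩
  tfae_finish
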